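/- Compact groups are assumed to be Hausdorff. A compact Lie group is a compact group having a neighborhood of the identity that contains no nontrivial subgroup; $\mathbb{T}$ is the circle group, and the weight $w(G)$ is the least cardinality of a base of the topology of $G$ (cardinals are identified with initial ordinals). A transfinite inverse sequence $\langle G_\alpha, p_\alpha^\beta\rangle_{\alpha\le\beta<\kappa}$ of topological groups and continuous homomorphisms $p_\alpha^\beta\colon G_\beta\to G_\alpha$ is continuous if for every limit ordinal $\delta<\kappa$ the group $G_\delta$, with the maps $p_\alpha^\delta$, is the inverse limit of $\langle G_\alpha, p_\alpha^\beta\rangle_{\alpha\le\beta<\delta}$. Let $G$ be a compact Abelian group. Then there are an ordinal $\kappa>0$ and a continuous inverse sequence $\langle G_\alpha,p_\alpha^\beta\rangle_{\alpha\le\beta<\kappa}$ of compact groups and continuous homomorphisms such that 1. $G=\varprojlim_{\alpha<\kappa}G_\alpha$ (up to isomorphism of topological groups); 2. $G_0$ is the trivial group; 3. for every $\alpha$ with $\alpha+1<\kappa$, either $p_\alpha^{\alpha+1}$ is an epimorphism (a surjective homomorphism) with finite kernel, or, up to isomorphism of topological groups, $G_{\alpha+1}=G_\alpha\times\mathbb{T}$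 and $p_\alpha^{\alpha+1}$ is the standard projection $G_\alpha\times\mathbb{T}\to G_\alpha$; 4. if $G$ is not a Lie group, then $\kappa=w(G)$. -/

import Mathlib

open Topology

universe u v w

/-- The weight `w(X)` of a topological space: the least cardinality of a base of its topology. -/
noncomputable def topWeight (X : Type u) [TopologicalSpace X] : Cardinal.{u} :=
  sInf {c | ∃ B : Set (Set X), TopologicalSpace.IsTopologicalBasis B ∧ Cardinal.mk B = c}

/-- A compact Lie group: a compact (Hausdorff) topological group in which some neighborhood of the
identity contains no nontrivial subgroup. -/
def IsCompactLieGroup (G : Type u) [Group G] [TopologicalSpace G] [IsTopologicalGroup G] : Prop :=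
  CompactSpace G ∧ T2Space G ∧
    ∃ U ∈ 𝓝 (1 : G), ∀ H : Subgroup G, (H : Set G) ⊆ U → H = ⊥

/-- An inverse system of topological groups and continuous homomorphisms, indexed by `I`. The
bonding map `p_i^j : G_j → G_i` is `bond h` for `h : i ≤ j`. -/
structure TopGroupInvSystem (I : Type v) [Preorder I] where
  obj : I → Type u
  [group : ∀ i, Group (obj i)]
  [topologicalSpace : ∀ i, TopologicalSpace (obj i)]
  [isTopologicalGroup : ∀ i, IsTopologicalGroup (obj i)]
  bond : ∀ {i j : I}, i ≤ j → (obj j →ₜ* obj i)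
  bond_refl : ∀ (i : I) (x : obj i), bond (le_refl i) x = x
  bond_bond : ∀ {i j k : I} (hij : i ≤ j) (hjk : j ≤ k) (x : obj k),
    bond hij (bond hjk x) = bond (hij.trans hjk) x

namespace TopGroupInvSystem

attribute [instance] group topologicalSpace isTopologicalGroup

variable {I : Type v} [Preorder I]

/-- The inverse limit: the group of threads, a topological subgroup of the product. -/
def limit (S : TopGroupInvSystem.{u} I) : Subgroup (∀ i, S.obj i) where
  carrier := {x | ∀ (i j : I) (h : i ≤ j), S.bond h (x j) = x i}
  mul_mem' := fun {a b} ha hb i j h => by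
    simp only [Pi.mul_apply, map_mul, ha i j h, hb i j h]
  one_mem' := fun i j h => by simp only [Pi.one_apply, map_one]
  inv_mem' := fun {a} ha i j h => by simp only [Pi.inv_apply, map_inv, ha i j h]

/-- The restriction of an inverse system to a set of indices. -/
def restrict (S : TopGroupInvSystem.{u} I) (s : Set I) : TopGroupInvSystem.{u} s where
  obj i := S.obj i
  bond {i j} h := S.bond (show (i : I) ≤ j from h)
  bond_refl i x := S.bond_refl i x
  bond_bond hij hjk x := S.bond_bond (show _ ≤ _ from hij) (show _ ≤ _ from hjk) x

/-- `G`, with the projections `π i : G → G_i`, is the limit of the system: the map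
`g ↦ (π i g)_i` is an isomorphism of topological groups of `G` onto the group of threads. -/
def IsLimitCone (S : TopGroupInvSystem.{u} I) {G : Type w} [Group G] [TopologicalSpace G]
    (π : ∀ i, G →ₜ* S.obj i) : Prop :=
  ∃ e : G ≃ₜ* S.limit, ∀ (g : G) (i : I), (e g : ∀ i, S.obj i) i = π i g

/-- A transfinite inverse sequence `(G_α)_{α < κ}` is continuous if for each limit ordinal
`δ < κ` the group `G_δ`, with the bonding maps `p_α^δ`, is the limit of `(G_α)_{α < δ}`. -/
def IsContinuousSeq {κ : Ordinal.{w}} (S : TopGroupInvSystem.{u} (Set.Iio κ)) : Prop :=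
  ∀ δ : Set.Iio κ, Order.IsSuccLimit (δ : Ordinal.{w}) →
    (S.restrict (Set.Iio δ)).IsLimitCone
      (fun α => S.bond (show (α : Set.Iio κ) ≤ δ from le_of_lt α.2))

/-- The successor bonding map `p_α^{α+1} : G_{α+1} → G_α` of a sequence `(G_α)_{α < κ}`. -/
def succBond {κ : Ordinal.{w}} (S : TopGroupInvSystem.{u} (Set.Iio κ)) (α : Ordinal.{w})
    (h : α + 1 < κ) :
    S.obj ⟨α + 1, h⟩ →ₜ* S.obj ⟨α, (Order.lt_add_one_iff.mpr le_rfl).trans h⟩ :=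
  S.bond (Subtype.mk_le_mk.mpr (Order.lt_add_one_iff.mpr le_rfl).le)

end TopGroupInvSystem

/-- A continuous epimorphism with finite kernel. -/
def IsFiniteKernelEpi {A B : Type*} [Group A] [TopologicalSpace A] [Group B] [TopologicalSpace B]
    (p : A →ₜ* B) : Prop :=
  Function.Surjective p ∧ {x : A | p x = 1}.Finite

/-- Up to an isomorphism `A ≅ B × 𝕋` of topological groups, `p` is the standard projection
`B × 𝕋 → B`. -/
def IsCircleProjection {A B : Type*} [Group A] [TopologicalSpace A] [Group B] [TopologicalSpace B]
    (p : A →ₜ* B) : Prop :=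
  ∃ e : A ≃ₜ* B × Circle, ∀ x : A, (e x).1 = p x

/-!
Characters separate the points of `G`: averaging the rank-one operator of a vector `v` over the
regular representation on `L²(G)` gives a nonzero self-adjoint operator commuting with all
translations, and left multiplication of it by the translations is norm continuous. A character of
the commutative C⋆-algebra that the operator and the translations generate, chosen to see that a
given translation moves the operator, restricts to a continuous character of `G`. One character for
each member of a base suffices, so the characters can be enumerated by the initial ordinal of
`max ℵ₀ w(G)`, and `G_α` is the quotient of `G` by the common kernel of the first `α` of them. The
kernel of `G_{α+1} → G_α` embeds into the circle by the character of index `α`, hence is finite or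
the whole circle; in the latter case the character splits the extension. Compactness makes `G`
surject onto inverse limits of its quotients.
-/

section CStarAlgebra

open WeakDual

/-- The restriction of a character of a commutative C⋆-algebra to its unitary group. -/
noncomputable def characterOnUnitary {C : Type*} [CommCStarAlgebra C] (φ : characterSpace ℂ C) :
    unitary C →* Circle where
  toFun u := ⟨φ u, mem_sphere_zero_iff_norm.2
    (CStarRing.norm_of_mem_unitary (Unitary.map_mem φ u.2))⟩
  map_one' := Circle.ext (map_one φ)
  map_mul' u v := Circle.ext (map_mul φ (u : C) v)

theorem exists_characterSpace_apply_ne_zero {C : Type*} [CommCStarAlgebra C] {a : C}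
    (ha : a ≠ 0) : ∃ φ : characterSpace ℂ C, φ a ≠ 0 := by
  by_contra! h
  exact ha ((gelfandTransform_isometry C).injective (by ext φ; simpa using h φ))

variable {G : Type*} [Monoid G] [TopologicalSpace G]

theorem exists_circle_character_of_commCStarAlgebra {C : Type*} [CommCStarAlgebra C]
    (u : G →* unitary C) {t : C} (hcont : Continuous fun g => (u g : C) * t) {g : G}
    (hg : (u g : C) * t ≠ t) : ∃ χ : G →ₜ* Circle, χ g ≠ 1 := by
  obtain ⟨φ, hφ⟩ := exists_characterSpace_apply_ne_zero (sub_ne_zero.2 hg)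
  have hφ : (φ (u g) - 1) * φ t ≠ 0 := by rwa [sub_mul, one_mul, ← map_mul, ← map_sub]
  have hφcont : Continuous fun g => φ (u g) := by
    have heq : (fun g => φ (u g)) = fun g => φ (u g * t) / φ t := by
      ext g
      rw [map_mul, mul_div_cancel_right₀ _ (right_ne_zero_of_mul hφ)]
    rw [heq]
    exact ((map_continuous φ).comp hcont).div_const _
  refine ⟨⟨(characterOnUnitary φ).comp u, hφcont.subtype_mk _⟩, fun h => ?_⟩
  exact left_ne_zero_of_mul hφ (sub_eq_zero.2 (congrArg Subtype.val h))

theorem commute_star_right_of_mem_unitary {R : Type*} [Monoid R] [StarMul R] {a u : R}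
    (h : Commute a u) (hu : u ∈ unitary R) : Commute a (star u) :=
  Commute.units_inv_right (u := Unitary.toUnits ⟨u, hu⟩) h

-- A commuting unitary family and `t` generate a commutative C⋆-subalgebra.
theorem exists_circle_character_of_cStarAlgebra {A : Type*} [CStarAlgebra A]
    (u : G →* unitary A) {t : A} [IsStarNormal t] (hu : ∀ g h, Commute (u g) (u h))
    (hut : ∀ g, Commute (u g : A) t) (hcont : Continuous fun g => (u g : A) * t) {g : G}
    (hg : (u g : A) * t ≠ t) : ∃ χ : G →ₜ* Circle, χ g ≠ 1 := by
  let s : Set A := insert t (Set.range fun g => (u g : A))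
  have hcomm : ∀ a ∈ s, ∀ b ∈ s, Commute a b := by
    rintro _ (rfl | ⟨g, rfl⟩) _ (rfl | ⟨h, rfl⟩)
    · exact .refl _
    · exact (hut h).symm
    · exact hut g
    · exact congrArg Subtype.val (hu g h)
  have hcomm_star : ∀ a ∈ s, ∀ b ∈ s, Commute a (star b) := by
    rintro _ (rfl | ⟨g, rfl⟩) _ (rfl | ⟨h, rfl⟩)
    · exact IsStarNormal.star_comm_self.symm
    · exact commute_star_right_of_mem_unitary (hut h).symm (u h).2
    · exact commute_star_comm.1 (commute_star_right_of_mem_unitary (hut g).symm (u g).2).symm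
    · exact commute_star_right_of_mem_unitary (hcomm _ (.inr ⟨g, rfl⟩) _ (.inr ⟨h, rfl⟩)) (u h).2
  let S := StarAlgebra.adjoin ℂ s
  have hs : s ⊆ S.topologicalClosure := (StarAlgebra.subset_adjoin ℂ s).trans subset_closure
  have := StarAlgebra.isMulCommutative_adjoin ℂ hcomm hcomm_star
  have : IsClosed (S.topologicalClosure : Set A) := S.isClosed_topologicalClosure
  let _ : CommCStarAlgebra S.topologicalClosure :=
    { StarSubalgebra.cstarAlgebra S.topologicalClosure,
      S.commRingTopologicalClosure (mul_comm' · ·) with }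
  let u' : G →* unitary S.topologicalClosure :=
    { toFun g := ⟨⟨u g, hs (.inr ⟨g, rfl⟩)⟩, Subtype.ext (u g).2.1, Subtype.ext (u g).2.2⟩
      map_one' := by ext; simp
      map_mul' g h := by ext; simp }
  exact exists_circle_character_of_commCStarAlgebra u' (t := ⟨t, hs (.inl rfl)⟩)
    (hcont.subtype_mk _) fun h => hg (congrArg Subtype.val h)

end CStarAlgebra

section OrbitOperator

open MeasureTheory InnerProductSpace

theorem continuous_rankOne {𝕜 E F : Type*} [RCLike 𝕜] [SeminormedAddCommGroup E]
    [NormedSpace 𝕜 E] [SeminormedAddCommGroup F] [InnerProductSpace 𝕜 F] :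
    Continuous fun p : E × F => rankOne 𝕜 p.1 p.2 := by
  have hsmulRight : Continuous fun p : E × F =>
      ContinuousLinearMap.smulRightL 𝕜 F E (innerSL 𝕜 p.2) := by fun_prop
  exact hsmulRight.clm_apply continuous_fst

variable {G : Type*} [Group G] [MeasurableSpace G] (μ : Measure G)
  {H : Type*} [NormedAddCommGroup H] [InnerProductSpace ℂ H] {U : G →* (H ≃ₗᵢ[ℂ] H)}

/-- The average over `G` of the rank-one operators `z ↦ ⟪U x w, z⟫ • U x v`, for a unitary
representation `U` of `G`, as a Bochner integral in operator norm. -/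
noncomputable def orbitOperator (U : G →* (H ≃ₗᵢ[ℂ] H)) (v w : H) : H →L[ℂ] H :=
  ∫ x, rankOne ℂ (U x v) (U x w) ∂μ

theorem norm_orbitOperator_le [IsFiniteMeasure μ] (v w : H) :
    ‖orbitOperator μ U v w‖ ≤ ‖v‖ * ‖w‖ * μ.real Set.univ :=
  norm_integral_le_of_norm_le_const <| .of_forall fun x => by simp

theorem isSelfAdjoint_orbitOperator_self [CompleteSpace H] (v : H) :
    IsSelfAdjoint (orbitOperator μ U v v) := by
  rw [isSelfAdjoint_iff, orbitOperator]
  refine ((starL' ℝ).integral_comp_comm _).symm.trans ?_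
  simp [ContinuousLinearMap.star_eq_adjoint]

variable [TopologicalSpace G] [CompactSpace G] [OpensMeasurableSpace G]
  [IsFiniteMeasureOnCompacts μ] (hU : ∀ v, Continuous fun x => U x v)

include hU

theorem integrable_rankOne_orbit (v w : H) :
    Integrable (fun x => rankOne ℂ (U x v) (U x w)) μ :=
  Continuous.integrable_of_hasCompactSupport
    (continuous_rankOne.comp ((hU v).prodMk (hU w))) (.of_compactSpace _)

theorem orbitOperator_sub_left (v v' w : H) :
    orbitOperator μ U (v - v') w = orbitOperator μ U v w - orbitOperator μ U v' w := by
  simp only [orbitOperator, map_sub, sub_apply]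
  exact integral_sub (integrable_rankOne_orbit μ hU v w) (integrable_rankOne_orbit μ hU v' w)

theorem continuous_orbitOperator_left (w : H) : Continuous fun v => orbitOperator μ U v w := by
  refine (LipschitzWith.of_dist_le' (K := ‖w‖ * μ.real Set.univ) fun v v' => ?_).continuous
  rw [dist_eq_norm, dist_eq_norm, ← orbitOperator_sub_left μ hU]
  exact (norm_orbitOperator_le μ (v - v') w).trans_eq (by ring)

theorem mul_orbitOperator (T : H →L[ℂ] H) (v w : H) :
    T * orbitOperator μ U v w = ∫ x, rankOne ℂ (T (U x v)) (U x w) ∂μ := by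
  rw [orbitOperator, ← integral_const_mul_of_integrable (integrable_rankOne_orbit μ hU v w)]
  simp only [ContinuousLinearMap.mul_def, comp_rankOne]

theorem orbitOperator_mul [CompleteSpace H] (T : H →L[ℂ] H) (v w : H) :
    orbitOperator μ U v w * T = ∫ x, rankOne ℂ (U x v) (T.adjoint (U x w)) ∂μ := by
  rw [orbitOperator, ← integral_mul_const_of_integrable (integrable_rankOne_orbit μ hU v w)]
  simp only [ContinuousLinearMap.mul_def, rankOne_comp]

theorem map_mul_orbitOperator {g : G} (hg : ∀ x, Commute g x) (v w : H) :
    (U g : H →L[ℂ] H) * orbitOperator μ U v w = orbitOperator μ U (U g v) w := by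
  have hcomm (x : G) : U g (U x v) = U x (U g v) := DFunLike.congr_fun ((hg x).map U) v
  rw [mul_orbitOperator μ hU, orbitOperator]
  exact integral_congr_ae (.of_forall fun x => congrArg (rankOne ℂ · (U x w)) (hcomm x))

theorem commute_map_orbitOperator [CompleteSpace H] [MeasurableMul G] [μ.IsMulLeftInvariant]
    (g : G) (v w : H) : Commute (U g : H →L[ℂ] H) (orbitOperator μ U v w) := by
  have hadj (x : G) : (U g : H →L[ℂ] H).adjoint (U (g * x) w) = U x w := by
    rw [LinearIsometryEquiv.adjoint_eq_symm, map_mul]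
    exact (U g).symm_apply_apply (U x w)
  rw [Commute, SemiconjBy, mul_orbitOperator μ hU, orbitOperator_mul μ hU,
    ← integral_mul_left_eq_self
      (fun x => rankOne ℂ (U x v) ((U g : H →L[ℂ] H).adjoint (U x w))) g]
  refine integral_congr_ae (.of_forall fun x => ?_)
  change rankOne ℂ (U g (U x v)) (U x w) = rankOne ℂ (U (g * x) v) _
  rw [hadj x, map_mul]
  rfl

theorem inner_orbitOperator_self [CompleteSpace H] (v w : H) :
    inner ℂ w (orbitOperator μ U v v w) = (∫ x, ‖inner ℂ (U x v) w‖ ^ 2 ∂μ : ℝ) := by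
  have hint := integrable_rankOne_orbit μ hU v v
  rw [orbitOperator, ContinuousLinearMap.integral_apply hint,
    ← integral_inner (hint.apply_continuousLinearMap w), ← integral_complex_ofReal]
  refine integral_congr_ae (.of_forall fun x => ?_)
  simp only [inner_right_rankOne_apply, Complex.ofReal_pow]
  rw [← inner_conj_symm w]
  exact RCLike.conj_mul _

theorem orbitOperator_self_ne_zero [CompleteSpace H] [μ.IsOpenPosMeasure] {v : H} (hv : v ≠ 0) :
    orbitOperator μ U v v v ≠ 0 := by
  have hcont : Continuous fun x => ‖inner ℂ (U x v) v‖ ^ 2 := by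
    have := hU v
    fun_prop
  have hpos : 0 < ∫ x, ‖inner ℂ (U x v) v‖ ^ 2 ∂μ :=
    hcont.integral_pos_of_hasCompactSupport_nonneg_nonzero (.of_compactSpace _)
      (fun x => sq_nonneg _) (x := 1) (by simpa using hv)
  intro h
  have := inner_orbitOperator_self μ hU v v
  rw [h, inner_zero_right] at this
  exact hpos.ne (Complex.ofReal_eq_zero.1 this.symm).symm

end OrbitOperator

section RegularRepresentation

open MeasureTheory

theorem exists_circle_character_of_unitaryRep {G : Type*} [CommGroup G] [TopologicalSpace G]
    [IsTopologicalGroup G] [CompactSpace G] {H : Type*} [NormedAddCommGroup H]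
    [InnerProductSpace ℂ H] [CompleteSpace H] (U : G →* (H ≃ₗᵢ[ℂ] H))
    (hU : ∀ v, Continuous fun x => U x v) {g : G} (hg : U g ≠ 1) :
    ∃ χ : G →ₜ* Circle, χ g ≠ 1 := by
  borelize G
  let μ : Measure G := Measure.haar
  obtain ⟨v, hv⟩ : ∃ v, U g v - v ≠ 0 := by
    contrapose! hg
    exact LinearIsometryEquiv.ext fun v => sub_eq_zero.1 (hg v)
  let t := orbitOperator μ U (U g v - v) (U g v - v)
  have hUt (x : G) : Commute (U x : H →L[ℂ] H) t := commute_map_orbitOperator μ hU x _ _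
  have : IsStarNormal t := (isSelfAdjoint_orbitOperator_self μ _).isStarNormal
  refine exists_circle_character_of_cStarAlgebra
    (Unitary.linearIsometryEquiv.symm.toMonoidHom.comp U) (t := t)
    (fun x y => ((Commute.all x y).map U).map Unitary.linearIsometryEquiv.symm) hUt ?_ fun h => ?_
  · change Continuous fun x => (U x : H →L[ℂ] H) * t
    simp only [t, map_mul_orbitOperator μ hU (Commute.all _)]
    exact (continuous_orbitOperator_left μ hU _).comp (hU _)
  · refine orbitOperator_self_ne_zero μ hU hv ?_
    have hgt : t * (U g : H →L[ℂ] H) = t := (hUt g).eq.symm.trans h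
    rw [map_sub, sub_eq_zero]
    exact congrArg (· v) hgt

/-- The regular representation of `G` on `L²(G)`, `(g • f)(x) = f (g⁻¹ * x)`. -/
noncomputable def regularRep {G : Type*} [Group G] [MeasurableSpace G] [MeasurableMul G]
    (μ : Measure G) [μ.IsMulLeftInvariant] : G →* (Lp ℂ 2 μ ≃ₗᵢ[ℂ] Lp ℂ 2 μ) where
  toFun g :=
    { DistribMulAction.toLinearEquiv ℂ (Lp ℂ 2 μ) (DomMulAct.mk g⁻¹) with
      norm_map' := DomMulAct.norm_smul_Lp _ }
  map_one' := LinearIsometryEquiv.ext fun f => by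
    change DomMulAct.mk (1 : G)⁻¹ • f = f
    rw [inv_one, DomMulAct.mk_one, one_smul]
  map_mul' g h := LinearIsometryEquiv.ext fun f => by
    change DomMulAct.mk (g * h)⁻¹ • f = DomMulAct.mk g⁻¹ • DomMulAct.mk h⁻¹ • f
    rw [mul_inv_rev, DomMulAct.mk_mul, mul_smul]

section

variable {G : Type*} [Group G] [TopologicalSpace G] [IsTopologicalGroup G] [CompactSpace G]
  [MeasurableSpace G] [BorelSpace G] (μ : Measure G) [μ.IsMulLeftInvariant]

theorem continuous_regularRep_apply [μ.Regular] (f : Lp ℂ 2 μ) :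
    Continuous fun g => regularRep μ g f :=
  have : Fact ((2 : ENNReal) ≠ ⊤) := ⟨ENNReal.ofNat_ne_top⟩
  (DomMulAct.continuous_mk.comp continuous_inv).smul continuous_const

theorem regularRep_toLp [IsFiniteMeasureOnCompacts μ] (g : G) (f : C(G, ℂ)) :
    regularRep μ g (ContinuousMap.toLp 2 μ ℂ f) =
      ContinuousMap.toLp 2 μ ℂ (f.comp (ContinuousMap.mulLeft g⁻¹)) := rfl

theorem regularRep_injective [T2Space G] [IsFiniteMeasureOnCompacts μ] [μ.IsOpenPosMeasure] :
    Function.Injective (regularRep μ) := by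
  refine (injective_iff_map_eq_one _).2 fun g hg => ?_
  by_contra hg1
  obtain ⟨f, hf0, hf1, -⟩ := exists_continuous_zero_one_of_isClosed
    isClosed_singleton isClosed_singleton (Set.disjoint_singleton.2 hg1)
  let F : C(G, ℂ) := (⟨Complex.ofReal, Complex.continuous_ofReal⟩ : C(ℝ, ℂ)).comp f
  have h := (regularRep_toLp μ g F).symm
  rw [hg] at h
  have hF := DFunLike.congr_fun (ContinuousMap.toLp_injective μ h) g
  simp [F, hf0 rfl, hf1 rfl] at hF

end

theorem exists_circle_character_ne_one {G : Type*} [CommGroup G] [TopologicalSpace G]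
    [IsTopologicalGroup G] [CompactSpace G] [T2Space G] {g : G} (hg : g ≠ 1) :
    ∃ χ : G →ₜ* Circle, χ g ≠ 1 := by
  borelize G
  exact exists_circle_character_of_unitaryRep (regularRep Measure.haar)
    (continuous_regularRep_apply _) fun h => hg (regularRep_injective _ (h.trans (map_one _).symm))

end RegularRepresentation

theorem finite_or_eq_top_of_isClosed_subgroup_circle {H : Subgroup Circle}
    (hH : IsClosed (H : Set Circle)) : (H : Set Circle).Finite ∨ H = ⊤ := by
  let e : UnitAddCircle ≃ₜ Circle := AddCircle.homeomorphCircle one_ne_zero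
  let K : AddSubgroup UnitAddCircle :=
    H.toAddSubgroup.comap AddCircle.toCircle_addChar.toAddMonoidHom
  have hKH : (K : Set _) = e ⁻¹' H := by
    ext x
    rw [Set.mem_preimage, AddCircle.homeomorphCircle_apply]
    rfl
  by_cases hdense : Dense (K : Set UnitAddCircle)
  · right
    have hK : (K : Set UnitAddCircle) = Set.univ := by
      rw [← hdense.closure_eq, hKH, (hH.preimage (map_continuous _)).closure_eq]
    rw [hKH, Set.preimage_eq_univ_iff, e.surjective.range_eq] at hK
    exact SetLike.coe_injective (Set.univ_subset_iff.1 hK)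
  · left
    rw [AddCircle.dense_addSubgroup_iff_ne_zmultiples] at hdense
    push Not at hdense
    obtain ⟨a, ha, hK⟩ := hdense
    have hfin : (K : Set UnitAddCircle).Finite :=
      hK ▸ (addOrderOf_ne_zero_iff.1 ha).finite_zmultiples
    rw [← e.image_preimage H]
    exact (hKH ▸ hfin).image _

section Dichotomy

variable {A B C : Type*} [Group A] [Group B] [Group C]

theorem bijective_prod_of_map_ker_eq_top {p : A →* B} {χ : A →* C}
    (hp : Function.Surjective p) (hker : p.ker ⊓ χ.ker = ⊥) (htop : p.ker.map χ = ⊤) :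
    Function.Bijective (p.prod χ) := by
  refine ⟨(MonoidHom.ker_eq_bot_iff _).1 ((MonoidHom.ker_prod p χ).trans hker), fun ⟨b, c⟩ => ?_⟩
  obtain ⟨a, rfl⟩ := hp b
  obtain ⟨k, hk, hkc⟩ : (χ a)⁻¹ * c ∈ p.ker.map χ := htop ▸ Subgroup.mem_top _
  refine ⟨a * k, Prod.ext ?_ ?_⟩
  · simp [MonoidHom.mem_ker.1 hk]
  · simp [hkc]

theorem finite_ker_of_finite_map_ker {p : A →* B} {χ : A →* C} (hker : p.ker ⊓ χ.ker = ⊥)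
    (hfin : (p.ker.map χ : Set C).Finite) : (p.ker : Set A).Finite := by
  refine hfin.of_finite_image fun x hx y hy hxy => ?_
  have : x / y ∈ p.ker ⊓ χ.ker :=
    ⟨p.ker.div_mem hx hy, MonoidHom.mem_ker.2 (by rw [map_div, div_eq_one, hxy])⟩
  rwa [hker, Subgroup.mem_bot, div_eq_one] at this

variable [TopologicalSpace A] [TopologicalSpace B] [TopologicalSpace C] [CompactSpace A]

/-- A bijective continuous homomorphism from a compact group to a Hausdorff group, as an
isomorphism of topological groups. -/
noncomputable def continuousMulEquivOfBijective [T2Space B] (f : A →ₜ* B)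
    (hf : Function.Bijective f) : A ≃ₜ* B where
  toMulEquiv := MulEquiv.ofBijective f hf
  continuous_toFun := map_continuous f
  continuous_invFun := by
    have he : Continuous (Equiv.ofBijective f hf) := map_continuous f
    exact he.homeoOfEquivCompactToT2.continuous_symm

theorem isFiniteKernelEpi_or_isCircleProjection [T2Space B] {p : A →ₜ* B} {χ : A →ₜ* Circle}
    (hp : Function.Surjective p) (hker : p.toMonoidHom.ker ⊓ χ.toMonoidHom.ker = ⊥) :
    IsFiniteKernelEpi p ∨ IsCircleProjection p := by
  have hclosed : IsClosed (p.toMonoidHom.ker.map χ.toMonoidHom : Set Circle) :=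
    ((isClosed_singleton.preimage (map_continuous p)).isCompact.image (map_continuous χ)).isClosed
  obtain hfin | htop := finite_or_eq_top_of_isClosed_subgroup_circle hclosed
  · exact .inl ⟨hp, finite_ker_of_finite_map_ker hker hfin⟩
  · exact .inr ⟨continuousMulEquivOfBijective (p.prod χ)
      (bijective_prod_of_map_ker_eq_top hp hker htop), fun _ => rfl⟩

end Dichotomy

namespace TopGroupInvSystem

section Limit

variable {I : Type v} [Preorder I] (S : TopGroupInvSystem.{u} I) {H : Type w} [Group H]
  [TopologicalSpace H]

/-- The homomorphism into the limit induced by a compatible family of homomorphisms. -/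
def limitLift (π : ∀ i, H →ₜ* S.obj i) (hπ : ∀ i j (h : i ≤ j) x, S.bond h (π j x) = π i x) :
    H →ₜ* S.limit where
  toFun x := ⟨fun i => π i x, fun i j h => hπ i j h x⟩
  map_one' := Subtype.ext (funext fun i => map_one (π i))
  map_mul' x y := Subtype.ext (funext fun i => map_mul (π i) x y)
  continuous_toFun := (continuous_pi fun i => map_continuous (π i)).subtype_mk _

variable {S} [Nonempty I] [IsDirectedOrder I] [CompactSpace H]
  {π : ∀ i, H →ₜ* S.obj i} (hπ : ∀ i j (h : i ≤ j) x, S.bond h (π j x) = π i x)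

include hπ in
-- The fibres of the `π i` over a thread are nonempty, compact and directed.
theorem limitLift_surjective [∀ i, T1Space (S.obj i)] (hsurj : ∀ i, Function.Surjective (π i)) :
    Function.Surjective (S.limitLift π hπ) := by
  rintro ⟨x, hx⟩
  have hclosed (i : I) : IsClosed (π i ⁻¹' {x i}) :=
    isClosed_singleton.preimage (map_continuous (π i))
  have hanti : Antitone fun i => π i ⁻¹' {x i} := fun i j h y (hy : π j y = x j) => by
    rw [Set.mem_preimage, Set.mem_singleton_iff, ← hπ i j h, hy, hx i j h]
  obtain ⟨y, hy⟩ := IsCompact.nonempty_iInter_of_directed_nonempty_isCompact_isClosed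
    _ hanti.directed_ge (fun i => hsurj i (x i)) (fun i => (hclosed i).isCompact) hclosed
  exact ⟨y, Subtype.ext (funext (Set.mem_iInter.1 hy))⟩

include hπ in
theorem isLimitCone_of_surjective [∀ i, T2Space (S.obj i)]
    (hsurj : ∀ i, Function.Surjective (π i)) (hinj : ⨅ i, (π i).toMonoidHom.ker = ⊥) :
    S.IsLimitCone π := by
  have hinj' : Function.Injective (S.limitLift π hπ) := by
    refine (injective_iff_map_eq_one _).2 fun x hx => ?_
    rw [← Subgroup.mem_bot, ← hinj, Subgroup.mem_iInf]
    exact congrFun (congrArg Subtype.val hx)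
  exact ⟨continuousMulEquivOfBijective _ ⟨hinj', limitLift_surjective hπ hsurj⟩, fun _ _ => rfl⟩

end Limit

section Quotient

variable {G : Type u} [Group G] [TopologicalSpace G]

/-- The quotient homomorphism `G → G ⧸ N` as a continuous homomorphism. -/
def quotientProj (N : Subgroup G) [N.Normal] : G →ₜ* G ⧸ N where
  toMonoidHom := QuotientGroup.mk' N
  continuous_toFun := QuotientGroup.continuous_mk

/-- The canonical homomorphism `G ⧸ N → G ⧸ M` for `N ≤ M` as a continuous homomorphism. -/
def quotientBond {M N : Subgroup G} [M.Normal] [N.Normal] (h : N ≤ M) : G ⧸ N →ₜ* G ⧸ M where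
  toMonoidHom := QuotientGroup.map N M (MonoidHom.id G) h
  continuous_toFun := QuotientGroup.continuous_mk.quotient_lift _

theorem quotientBond_surjective {M N : Subgroup G} [M.Normal] [N.Normal] (h : N ≤ M) :
    Function.Surjective (quotientBond h) :=
  QuotientGroup.map_surjective_of_surjective N M (MonoidHom.id G) QuotientGroup.mk_surjective h

variable [IsTopologicalGroup G] {I : Type v} [Preorder I]

theorem quotientBond_isFiniteKernelEpi_or_isCircleProjection [CompactSpace G]
    {M N : Subgroup G} [M.Normal] [N.Normal] (hM : IsClosed (M : Set G)) {χ : G →ₜ* Circle}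
    (hN : N = M ⊓ χ.toMonoidHom.ker) (h : N ≤ M) :
    IsFiniteKernelEpi (quotientBond h) ∨ IsCircleProjection (quotientBond h) := by
  let χ' : G ⧸ N →ₜ* Circle :=
    { QuotientGroup.lift N χ.toMonoidHom (hN.trans_le inf_le_right) with
      continuous_toFun := (map_continuous χ).quotient_lift _ }
  refine isFiniteKernelEpi_or_isCircleProjection (χ := χ') (quotientBond_surjective h) ?_
  refine (Subgroup.eq_bot_iff_forall _).2 (QuotientGroup.mk_surjective.forall.2 fun g hg => ?_)
  exact (QuotientGroup.eq_one_iff g).2 (hN ▸ ⟨(QuotientGroup.eq_one_iff g).1 hg.1, hg.2⟩)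

/-- The inverse system of the quotients of `G` by a decreasing family of normal subgroups. -/
def quotientSystem (N : I → Subgroup G) [∀ i, (N i).Normal] (hN : Antitone N) :
    TopGroupInvSystem.{u} I where
  obj i := G ⧸ N i
  bond h := quotientBond (hN h)
  bond_refl _ := QuotientGroup.mk_surjective.forall.2 fun _ => rfl
  bond_bond _ _ := QuotientGroup.mk_surjective.forall.2 fun _ => rfl

variable {N : I → Subgroup G} [∀ i, (N i).Normal] (hN : Antitone N)
  (hclosed : ∀ i, IsClosed (N i : Set G))

include hclosed in
theorem t2Space_quotientSystem_obj (i : I) : T2Space ((quotientSystem N hN).obj i) :=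
  have := hclosed i
  inferInstanceAs (T2Space (G ⧸ N i))

variable [CompactSpace G]

theorem compactSpace_quotientSystem_obj (i : I) : CompactSpace ((quotientSystem N hN).obj i) :=
  inferInstanceAs (CompactSpace (G ⧸ N i))

include hclosed

theorem isLimitCone_quotientProj [Nonempty I] [IsDirectedOrder I] (hbot : ⨅ i, N i = ⊥) :
    (quotientSystem N hN).IsLimitCone fun i => quotientProj (N i) := by
  have (i : I) : T2Space ((quotientSystem N hN).obj i) := t2Space_quotientSystem_obj hN hclosed i
  refine isLimitCone_of_surjective (fun _ _ _ _ => rfl) (fun i => QuotientGroup.mk_surjective) ?_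
  exact (iInf_congr fun i => QuotientGroup.ker_mk' (N i)).trans hbot

theorem isLimitCone_restrict_quotientSystem {i : I} [Nonempty (Set.Iio i)]
    [IsDirectedOrder (Set.Iio i)] (hi : ⨅ j : Set.Iio i, N j = N i) :
    ((quotientSystem N hN).restrict (Set.Iio i)).IsLimitCone
      fun j => (quotientSystem N hN).bond (show (j : I) ≤ i from le_of_lt j.2) := by
  have (j : Set.Iio i) : T2Space (((quotientSystem N hN).restrict (Set.Iio i)).obj j) :=
    t2Space_quotientSystem_obj hN hclosed j.1
  have : CompactSpace ((quotientSystem N hN).obj i) := compactSpace_quotientSystem_obj hN i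
  refine isLimitCone_of_surjective (fun j k h => (quotientSystem N hN).bond_bond h (le_of_lt k.2))
    (fun j => quotientBond_surjective _) ?_
  refine (Subgroup.eq_bot_iff_forall _).2 (QuotientGroup.mk_surjective.forall.2 fun g hg => ?_)
  refine (QuotientGroup.eq_one_iff g).2 (hi ▸ Subgroup.mem_iInf.2 fun j => ?_)
  exact (QuotientGroup.eq_one_iff g).1 (Subgroup.mem_iInf.1 hg j)

end Quotient

end TopGroupInvSystem

section CommonKernel

variable {G : Type u} [Group G] [TopologicalSpace G] {A : Type*} [Monoid A]
  [TopologicalSpace A]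

/-- The common kernel of the homomorphisms with index below `i`. -/
def commonKernel {I : Type*} [Preorder I] (χ : I → (G →ₜ* A)) (i : I) : Subgroup G :=
  ⨅ j < i, (χ j).toMonoidHom.ker

section Preorder

variable {I : Type*} [Preorder I] (χ : I → (G →ₜ* A))

theorem mem_commonKernel {χ : I → (G →ₜ* A)} {i : I} {g : G} :
    g ∈ commonKernel χ i ↔ ∀ j < i, χ j g = 1 := by
  simp only [commonKernel, Subgroup.mem_iInf]
  rfl

instance commonKernel_normal (i : I) : (commonKernel χ i).Normal :=
  Subgroup.normal_iInf_normal fun j => Subgroup.normal_iInf_normal fun _ => (χ j).normal_ker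

theorem antitone_commonKernel : Antitone (commonKernel χ) :=
  fun _ _ h => biInf_mono fun _ hj => lt_of_lt_of_le hj h

theorem isClosed_commonKernel [T1Space A] (i : I) : IsClosed (commonKernel χ i : Set G) := by
  simp only [commonKernel, Subgroup.coe_iInf]
  exact isClosed_biInter fun j _ => isClosed_singleton.preimage (map_continuous (χ j))

theorem commonKernel_of_isMin {i : I} (hi : IsMin i) : commonKernel χ i = ⊤ := by
  simp [commonKernel, hi.not_lt]

end Preorder

variable {I : Type*} [LinearOrder I] (χ : I → (G →ₜ* A))

theorem commonKernel_of_covBy {i j : I} (h : i ⋖ j) :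
    commonKernel χ j = commonKernel χ i ⊓ (χ i).toMonoidHom.ker := by
  have hj (k : I) : k < j ↔ k < i ∨ k = i := h.lt_iff_le_left.trans le_iff_lt_or_eq
  simp only [commonKernel, hj, iInf_or, iInf_inf_eq, iInf_iInf_eq_left]

theorem iInf_commonKernel_of_isLUB {ι : Sort*} {f : ι → I} {i : I}
    (hf : IsLUB (Set.range f) i) : ⨅ k, commonKernel χ (f k) = commonKernel χ i := by
  refine le_antisymm (fun g hg => mem_commonKernel.2 fun j hj => ?_)
    (le_iInf fun k => antitone_commonKernel χ (hf.1 ⟨k, rfl⟩))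
  obtain ⟨_, ⟨k, rfl⟩, hk⟩ := (lt_isLUB_iff hf).1 hj
  exact mem_commonKernel.1 (Subgroup.mem_iInf.1 hg k) j hk

end CommonKernel

section Weight

theorem exists_isTopologicalBasis_mk_eq_topWeight (X : Type u) [TopologicalSpace X] :
    ∃ B : Set (Set X), TopologicalSpace.IsTopologicalBasis B ∧ Cardinal.mk B = topWeight X :=
  csInf_mem (s := {c | ∃ B : Set (Set X), TopologicalSpace.IsTopologicalBasis B ∧
    Cardinal.mk B = c}) ⟨_, _, TopologicalSpace.isTopologicalBasis_opens, rfl⟩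

theorem aleph0_le_topWeight (X : Type u) [TopologicalSpace X] [T0Space X] [Infinite X] :
    Cardinal.aleph0 ≤ topWeight X := by
  obtain ⟨B, hB, hBX⟩ := exists_isTopologicalBasis_mk_eq_topWeight X
  have hinj : Function.Injective fun x : X => {b : B | x ∈ (b : Set X)} := fun x y hxy =>
    hB.eq_iff.2 fun b hb => Set.ext_iff.1 hxy ⟨b, hb⟩
  rw [← hBX, ← Cardinal.infinite_iff]
  exact not_finite_iff_infinite.1 fun _ => (Infinite.of_injective _ hinj).not_finite inferInstance

theorem infinite_of_not_isCompactLieGroup {G : Type u} [Group G] [TopologicalSpace G]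
    [IsTopologicalGroup G] [T2Space G] (hG : ¬ IsCompactLieGroup G) : Infinite G := by
  by_contra hfin
  rw [not_infinite_iff_finite] at hfin
  refine hG ⟨inferInstance, inferInstance, {1}, mem_nhds_discrete.2 rfl, fun H hH => ?_⟩
  exact (Subgroup.eq_bot_iff_forall H).2 hH

variable {G : Type u} [Group G] [TopologicalSpace G] {A : Type*} [Monoid A]
  [TopologicalSpace A] [T1Space A]

-- Choose for each basic open set a homomorphism that nowhere takes the value `1` on it, if any.
theorem exists_iInf_ker_eq_bot_of_isTopologicalBasis {B : Set (Set G)}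
    (hB : TopologicalSpace.IsTopologicalBasis B)
    (hsep : ∀ g : G, g ≠ 1 → ∃ χ : G →ₜ* A, χ g ≠ 1) :
    ∃ χ : B → (G →ₜ* A), ⨅ b, (χ b).toMonoidHom.ker = ⊥ := by
  have hchoice (b : B) : ∃ χ : G →ₜ* A, (∃ ψ : G →ₜ* A, ∀ x ∈ (b : Set G), ψ x ≠ 1) →
      ∀ x ∈ (b : Set G), χ x ≠ 1 := by
    by_cases h : ∃ ψ : G →ₜ* A, ∀ x ∈ (b : Set G), ψ x ≠ 1
    · exact h.imp fun ψ hψ _ => hψ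
    · exact ⟨1, fun h' => absurd h' h⟩
  choose χ hχ using hchoice
  refine ⟨χ, (Subgroup.eq_bot_iff_forall _).2 fun g hg => ?_⟩
  by_contra hne
  obtain ⟨ψ, hψ⟩ := hsep g hne
  obtain ⟨b, hb, hgb, hbψ⟩ := hB.exists_subset_of_mem_open (u := ψ ⁻¹' {1}ᶜ) hψ
    (isClosed_singleton.isOpen_compl.preimage (map_continuous ψ))
  exact hχ ⟨b, hb⟩ ⟨ψ, fun x hx => hbψ hx⟩ g hgb (Subgroup.mem_iInf.1 hg ⟨b, hb⟩)

theorem exists_commonKernel_ord_eq_bot (hsep : ∀ g : G, g ≠ 1 → ∃ χ : G →ₜ* A, χ g ≠ 1)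
    {c : Cardinal.{u}} (hc : topWeight G ≤ c) :
    ∃ χ : Ordinal.{u} → (G →ₜ* A), commonKernel χ c.ord = ⊥ := by
  obtain ⟨B, hB, hBG⟩ := exists_isTopologicalBasis_mk_eq_topWeight G
  obtain ⟨χ, hχ⟩ := exists_iInf_ker_eq_bot_of_isTopologicalBasis hB hsep
  obtain ⟨i⟩ : Cardinal.mk B ≤ Cardinal.mk c.ord.ToType := by
    rwa [Cardinal.mk_toType, Cardinal.card_ord, hBG]
  let j : B → Ordinal.{u} := fun b => (i b).toOrd
  have hj : Function.Injective j :=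
    Subtype.val_injective.comp (Ordinal.ToType.mk.symm.injective.comp i.injective)
  refine ⟨Function.extend j χ 1, le_bot_iff.1 (hχ ▸ le_iInf fun b g hg => ?_)⟩
  rw [← hj.extend_apply χ 1 b]
  exact mem_commonKernel.1 hg (j b) (i b).toOrd.2

end Weight

namespace TopGroupInvSystem

section KernelSequence

variable {G : Type u} [Group G] [TopologicalSpace G] [IsTopologicalGroup G] {A : Type*}
  [Monoid A] [TopologicalSpace A]

/-- The inverse sequence of the quotients of `G` by the common kernels of the first `α`
homomorphisms of a transfinite sequence, for `α < κ`. -/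
def kernelSequence (χ : Ordinal.{w} → (G →ₜ* A)) (κ : Ordinal.{w}) :
    TopGroupInvSystem.{u} (Set.Iio κ) :=
  quotientSystem (fun α => commonKernel χ α) fun _ _ h => antitone_commonKernel χ h

variable (χ : Ordinal.{w} → (G →ₜ* A)) {κ : Ordinal.{w}}

theorem subsingleton_kernelSequence_zero (hκ : 0 < κ) :
    Subsingleton ((kernelSequence χ κ).obj ⟨0, hκ⟩) :=
  QuotientGroup.subsingleton_iff.2 (commonKernel_of_isMin χ isMin_bot)

variable [CompactSpace G]

theorem isLimitCone_kernelSequence [T1Space A] (hκ : Order.IsSuccLimit κ)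
    (hχ : commonKernel χ κ = ⊥) :
    (kernelSequence χ κ).IsLimitCone fun α => quotientProj (commonKernel χ α) := by
  have : Nonempty (Set.Iio κ) := ⟨⟨0, hκ.bot_lt⟩⟩
  have hlub : IsLUB (Set.range fun α : Set.Iio κ => (α : Ordinal.{w})) κ := by
    rw [Subtype.range_coe]
    exact hκ.isLUB_Iio
  exact isLimitCone_quotientProj _ (fun α => isClosed_commonKernel χ _)
    ((iInf_commonKernel_of_isLUB χ hlub).trans hχ)

theorem isContinuousSeq_kernelSequence [T1Space A] : (kernelSequence χ κ).IsContinuousSeq := by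
  intro δ hδ
  have : Nonempty (Set.Iio δ) := ⟨⟨⟨0, hδ.bot_lt.trans δ.2⟩, hδ.bot_lt⟩⟩
  have hlub : IsLUB (Set.range fun α : Set.Iio δ => (α : Ordinal.{w})) δ := by
    have hrange : (Set.range fun α : Set.Iio δ => (α : Ordinal.{w})) = Set.Iio (δ : Ordinal.{w}) :=
      Set.Subset.antisymm (Set.range_subset_iff.2 fun α => α.2)
        fun β hβ => ⟨⟨⟨β, (Set.mem_Iio.1 hβ).trans δ.2⟩, hβ⟩, rfl⟩
    rw [hrange]
    exact hδ.isLUB_Iio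
  exact isLimitCone_restrict_quotientSystem _ (fun α => isClosed_commonKernel χ _)
    (iInf_commonKernel_of_isLUB χ hlub)

theorem succBond_kernelSequence (χ : Ordinal.{w} → (G →ₜ* Circle)) (α : Ordinal.{w})
    (h : α + 1 < κ) : IsFiniteKernelEpi ((kernelSequence χ κ).succBond α h) ∨
      IsCircleProjection ((kernelSequence χ κ).succBond α h) :=
  quotientBond_isFiniteKernelEpi_or_isCircleProjection (isClosed_commonKernel χ α)
    (commonKernel_of_covBy χ (Order.covBy_add_one α)) _

end KernelSequence

end TopGroupInvSystem

theorem mainTheorem4_general (G : Type u) [CommGroup G] [TopologicalSpace G] [IsTopologicalGroup G]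
    [CompactSpace G] [T2Space G] :
    ∃ (κ : Ordinal.{u}) (hκ : 0 < κ) (S : TopGroupInvSystem.{u} (Set.Iio κ)),
      (∀ α, CompactSpace (S.obj α) ∧ T2Space (S.obj α)) ∧
      S.IsContinuousSeq ∧
      (∃ π : ∀ α, G →ₜ* S.obj α, S.IsLimitCone π) ∧
      Subsingleton (S.obj ⟨0, hκ⟩) ∧
      (∀ (α : Ordinal.{u}) (h : α + 1 < κ),
        IsFiniteKernelEpi (S.succBond α h) ∨ IsCircleProjection (S.succBond α h)) ∧
      (Infinite G → κ = (topWeight G).ord) := by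
  obtain ⟨χ, hχ⟩ := exists_commonKernel_ord_eq_bot
    (fun g hg => exists_circle_character_ne_one hg) (le_max_right Cardinal.aleph0 (topWeight G))
  have hκ := Cardinal.isSuccLimit_ord (le_max_left Cardinal.aleph0 (topWeight G))
  refine ⟨_, hκ.bot_lt, .kernelSequence χ _, fun α => ⟨?_, ?_⟩,
    TopGroupInvSystem.isContinuousSeq_kernelSequence χ,
    ⟨_, TopGroupInvSystem.isLimitCone_kernelSequence χ hκ hχ⟩,
    TopGroupInvSystem.subsingleton_kernelSequence_zero χ _,
    TopGroupInvSystem.succBond_kernelSequence χ, fun _ => ?_⟩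
  · exact TopGroupInvSystem.compactSpace_quotientSystem_obj _ α
  · exact TopGroupInvSystem.t2Space_quotientSystem_obj _ (fun α => isClosed_commonKernel χ _) α
  · rw [max_eq_right (aleph0_le_topWeight G)]

theorem mainTheorem4 (G : Type u) [CommGroup G] [TopologicalSpace G] [IsTopologicalGroup G]
    [CompactSpace G] [T2Space G] :
    ∃ (κ : Ordinal.{u}) (hκ : 0 < κ) (S : TopGroupInvSystem.{u} (Set.Iio κ)),
      (∀ α, CompactSpace (S.obj α) ∧ T2Space (S.obj α)) ∧
      S.IsContinuousSeq ∧
      (∃ π : ∀ α, G →ₜ* S.obj α, S.IsLimitCone π) ∧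
      Subsingleton (S.obj ⟨0, hκ⟩) ∧
      (∀ (α : Ordinal.{u}) (h : α + 1 < κ),
        IsFiniteKernelEpi (S.succBond α h) ∨ IsCircleProjection (S.succBond α h)) ∧
      (¬ IsCompactLieGroup G → κ = (topWeight G).ord) := by
  obtain ⟨κ, hκ, S, hS, hcont, hlim, hzero, hsucc, hweight⟩ := mainTheorem4_general G
  exact ⟨κ, hκ, S, hS, hcont, hlim, hzero, hsucc,
    fun hG => hweight (infinite_of_not_isCompactLieGroup hG)⟩
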